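/- Let $H$ be an infinite-dimensional separable complex Hilbert space. Equip the set $\mathcal{C}^{\mathrm{sa}}$ of all (possibly unbounded) densely defined self-adjoint operators in $H$ with the graph metric $d_G(T_1,T_2)=\|(T_1+i)^{-1}-(T_2+i)^{-1}\|$. Then the subset $G\mathcal{C}^{\mathrm{sa}}$ of all invertible $T\in\mathcal{C}^{\mathrm{sa}}$ (those which map their domain bijectively onto $H$ with bounded inverse), with the metric $d_G$, is path connected. -/

import Mathlib

open scoped InnerProductSpace

/-- The set `𝒞ˢᵃ(H)` of all (possibly unbounded) densely defined self-adjoint operators in the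
complex Hilbert space `H`. Equality `T† = T` of partially defined operators includes equality of
the domains; closedness and density of the domain are automatic. -/
def SelfAdjointOperator (H : Type*) [NormedAddCommGroup H] [InnerProductSpace ℂ H]
    [CompleteSpace H] : Type _ :=
  {T : H →ₗ.[ℂ] H // IsSelfAdjoint T}

namespace SelfAdjointOperator

variable {H : Type*} [NormedAddCommGroup H] [InnerProductSpace ℂ H] [CompleteSpace H]

/-- The underlying partially defined operator. -/
def toLinearPMap (T : SelfAdjointOperator H) : H →ₗ.[ℂ] H := T.1

/-- `T` is invertible: there is a bounded, everywhere defined operator `S` on `H` with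
`S T x = x` for all `x` in the domain of `T`, and `S y` in the domain of `T` and `T S y = y`
for all `y` in `H`. -/
def IsInvertible (T : SelfAdjointOperator H) : Prop :=
  ∃ S : H →L[ℂ] H,
    (∀ x : T.toLinearPMap.domain, S (T.toLinearPMap x) = x) ∧
    ∀ y : H, ∃ h : S y ∈ T.toLinearPMap.domain, T.toLinearPMap ⟨S y, h⟩ = y

/-- The operator `T + i` on the domain of `T`. -/
noncomputable def addI (T : SelfAdjointOperator H) : T.toLinearPMap.domain →ₗ[ℂ] H :=
  T.toLinearPMap.toFun + Complex.I • T.toLinearPMap.domain.subtype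

theorem addI_apply (T : SelfAdjointOperator H) (x : T.toLinearPMap.domain) :
    T.addI x = T.toLinearPMap x + Complex.I • (x : H) := rfl

theorem adjoint_eq (T : SelfAdjointOperator H) : T.toLinearPMap.adjoint = T.toLinearPMap := T.2

theorem dense_domain (T : SelfAdjointOperator H) : Dense (T.toLinearPMap.domain : Set H) :=
  T.2.dense_domain

theorem isClosed (T : SelfAdjointOperator H) : T.toLinearPMap.IsClosed :=
  IsSelfAdjoint.isClosed T.2

theorem symmetric (T : SelfAdjointOperator H) (x y : T.toLinearPMap.domain) :
    ⟪T.toLinearPMap x, (y : H)⟫_ℂ = ⟪(x : H), T.toLinearPMap y⟫_ℂ := by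
  have h := LinearPMap.adjoint_isFormalAdjoint T.dense_domain
  rw [T.adjoint_eq] at h
  exact h x y

theorem inner_im (T : SelfAdjointOperator H) (x : T.toLinearPMap.domain) :
    (⟪T.toLinearPMap x, (x : H)⟫_ℂ).im = 0 := by
  have h := T.symmetric x x
  rw [← inner_conj_symm (x : H)] at h
  exact Complex.conj_eq_iff_im.mp h.symm

theorem norm_addI_sq (T : SelfAdjointOperator H) (x : T.toLinearPMap.domain) :
    ‖T.addI x‖ ^ 2 = ‖T.toLinearPMap x‖ ^ 2 + ‖(x : H)‖ ^ 2 := by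
  rw [addI_apply, @norm_add_sq ℂ, inner_smul_right, norm_smul]
  simp [T.inner_im x]

theorem norm_le_norm_addI (T : SelfAdjointOperator H) (x : T.toLinearPMap.domain) :
    ‖(x : H)‖ ≤ ‖T.addI x‖ :=
  le_of_sq_le_sq (by rw [T.norm_addI_sq]; nlinarith [sq_nonneg ‖T.toLinearPMap x‖])
    (norm_nonneg _)

theorem norm_apply_le_norm_addI (T : SelfAdjointOperator H) (x : T.toLinearPMap.domain) :
    ‖T.toLinearPMap x‖ ≤ ‖T.addI x‖ :=
  le_of_sq_le_sq (by rw [T.norm_addI_sq]; nlinarith [sq_nonneg ‖(x : H)‖])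
    (norm_nonneg _)

theorem addI_injective (T : SelfAdjointOperator H) : Function.Injective T.addI := by
  rw [injective_iff_map_eq_zero]
  intro x hx
  have h := T.norm_le_norm_addI x
  rw [hx, norm_zero, norm_le_zero_iff] at h
  exact Subtype.ext h

theorem isClosed_range_addI (T : SelfAdjointOperator H) :
    IsClosed (LinearMap.range T.addI : Set H) := by
  let φ : T.toLinearPMap.graph →L[ℂ] H :=
    (ContinuousLinearMap.snd ℂ H H + Complex.I • ContinuousLinearMap.fst ℂ H H).comp
      T.toLinearPMap.graph.subtypeL
  have hφ : ∀ p : T.toLinearPMap.graph, ∃ x : T.toLinearPMap.domain,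
      (p : H × H) = (↑x, T.toLinearPMap x) ∧ φ p = T.addI x := by
    rintro ⟨⟨a, b⟩, hp⟩
    obtain ⟨x, rfl, rfl⟩ := (LinearPMap.mem_graph_iff _).1 hp
    exact ⟨x, rfl, rfl⟩
  have hanti : AntilipschitzWith 1 φ := by
    refine AddMonoidHomClass.antilipschitz_of_bound φ fun p => ?_
    obtain ⟨x, hx, hx'⟩ := hφ p
    rw [hx', NNReal.coe_one, one_mul]
    change ‖(p : H × H)‖ ≤ _
    rw [hx, Prod.norm_def]
    exact max_le (T.norm_le_norm_addI x) (T.norm_apply_le_norm_addI x)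
  have hc : IsClosed (T.toLinearPMap.graph : Set (H × H)) := T.isClosed
  have : CompleteSpace T.toLinearPMap.graph := hc.completeSpace_coe
  have hr : (LinearMap.range T.addI : Set H) = Set.range φ := by
    ext y
    constructor
    · rintro ⟨x, rfl⟩
      exact ⟨⟨_, T.toLinearPMap.mem_graph x⟩, rfl⟩
    · rintro ⟨p, rfl⟩
      obtain ⟨x, -, hx⟩ := hφ p
      exact ⟨x, hx.symm⟩
  rw [hr]
  exact hanti.isClosed_range φ.uniformContinuous

theorem addI_surjective (T : SelfAdjointOperator H) : Function.Surjective T.addI := by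
  rw [← LinearMap.range_eq_top]
  have : CompleteSpace (LinearMap.range T.addI) := T.isClosed_range_addI.completeSpace_coe
  rw [← Submodule.orthogonal_eq_bot_iff, Submodule.eq_bot_iff]
  intro w hw
  have hw' : ∀ x : T.toLinearPMap.domain,
      ⟪Complex.I • w, (x : H)⟫_ℂ = ⟪w, T.toLinearPMap x⟫_ℂ := by
    intro x
    have h := (Submodule.mem_orthogonal' _ _).1 hw _ (LinearMap.mem_range_self T.addI x)
    rw [addI_apply, inner_add_right, inner_smul_right] at h
    rw [inner_smul_left, Complex.conj_I]
    linear_combination -h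
  have hmem : w ∈ T.toLinearPMap.adjoint.domain :=
    LinearPMap.mem_adjoint_domain_of_exists w ⟨_, hw'⟩
  have hmem' : w ∈ T.toLinearPMap.domain := by rwa [T.adjoint_eq] at hmem
  have him := T.inner_im ⟨w, hmem'⟩
  have h : ⟪Complex.I • w, w⟫_ℂ = ⟪T.toLinearPMap ⟨w, hmem'⟩, w⟫_ℂ :=
    (hw' ⟨w, hmem'⟩).trans (T.symmetric ⟨w, hmem'⟩ ⟨w, hmem'⟩).symm
  rw [← h, inner_smul_left, inner_self_eq_norm_sq_to_K, Complex.conj_I] at him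
  have h0 : ‖w‖ ^ 2 = 0 := by
    have : (-Complex.I * ((‖w‖ : ℂ)) ^ 2).im = -‖w‖ ^ 2 := by
      rw [← Complex.ofReal_pow, Complex.mul_im, Complex.ofReal_re, Complex.ofReal_im]; simp
    have h2 : -‖w‖ ^ 2 = 0 := this.symm.trans him
    linarith
  simpa using h0

/-- The bounded operator `(T + i)⁻¹ : H → H`. -/
noncomputable def resolventI (T : SelfAdjointOperator H) : H →L[ℂ] H :=
  (T.toLinearPMap.domain.subtype ∘ₗ
    (LinearEquiv.ofBijective T.addI ⟨T.addI_injective, T.addI_surjective⟩).symm.toLinearMap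
      ).mkContinuous 1 (by
    intro y
    obtain ⟨x, rfl⟩ := T.addI_surjective y
    have h : (LinearEquiv.ofBijective T.addI ⟨T.addI_injective, T.addI_surjective⟩).symm
        (T.addI x) = x := LinearEquiv.ofBijective_symm_apply_apply _ x
    simpa [h] using T.norm_le_norm_addI x)

theorem resolventI_addI (T : SelfAdjointOperator H) (x : T.toLinearPMap.domain) :
    T.resolventI (T.addI x) = x := by
  have h : (LinearEquiv.ofBijective T.addI ⟨T.addI_injective, T.addI_surjective⟩).symm
      (T.addI x) = x := LinearEquiv.ofBijective_symm_apply_apply _ x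
  simp [resolventI, h]

theorem le_of_resolventI_eq {T₁ T₂ : SelfAdjointOperator H}
    (h : T₁.resolventI = T₂.resolventI) : T₁.toLinearPMap ≤ T₂.toLinearPMap := by
  rw [← LinearPMap.le_graph_iff]
  rintro ⟨a, b⟩ hp
  obtain ⟨x, hx, hb⟩ := (LinearPMap.mem_graph_iff _).1 hp
  obtain ⟨z, hz⟩ := T₂.addI_surjective (T₁.addI x)
  have hxz : (z : H) = (x : H) := by
    rw [← T₁.resolventI_addI x, h, ← hz, T₂.resolventI_addI]
  rw [addI_apply, addI_apply, hxz] at hz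
  exact (LinearPMap.mem_graph_iff _).2 ⟨z, hxz.trans hx, (add_right_cancel hz).trans hb⟩

theorem resolventI_injective :
    Function.Injective (resolventI : SelfAdjointOperator H → H →L[ℂ] H) := fun _ _ h =>
  Subtype.ext (le_antisymm (le_of_resolventI_eq h) (le_of_resolventI_eq h.symm))

/-- The graph (gap) metric `d_G(T₁, T₂) = ‖(T₁ + i)⁻¹ - (T₂ + i)⁻¹‖`. -/
noncomputable def graphDist (T₁ T₂ : SelfAdjointOperator H) : ℝ :=
  ‖T₁.resolventI - T₂.resolventI‖

/-- `𝒞ˢᵃ(H)` as a metric space, with the graph metric. -/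
noncomputable instance instMetricSpace : MetricSpace (SelfAdjointOperator H) where
  dist := graphDist
  dist_self T := by simp [graphDist]
  dist_comm T₁ T₂ := norm_sub_rev _ _
  dist_triangle T₁ T₂ T₃ := norm_sub_le_norm_sub_add_norm_sub _ _ _
  eq_of_dist_eq_zero h := resolventI_injective (sub_eq_zero.1 (norm_eq_zero.1 h))

end SelfAdjointOperator

open Filter Topology

/-! Passing to inverses identifies the invertible self-adjoint operators with the bounded
self-adjoint injective `S`. Since `(T + i)⁻¹ = S (1 + iS)⁻¹` for `S = T⁻¹`, norm continuity of `S`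
gives graph continuity of `T` (`continuous_ofInverse`). It remains to connect the injective `S` in
norm.

A segment joins `S` to a symmetry `J = 2P - 1` with `J S ≥ 0` (`joinedIn_symmetry`). On an
infinite-dimensional space `1` and `-1` are joined through operators that are injective but need not
be surjective, so `T` may become unbounded on the way (`joinedIn_one_neg_one`). This rests on a
bounded self-adjoint operator without eigenvalues. Applied on an infinite-dimensional eigenspace of
`J`, it leads from `J` to `1`. -/

/-- The bounded self-adjoint operators with trivial kernel. -/
def injectiveSelfAdjoint (E : Type*) [NormedAddCommGroup E] [InnerProductSpace ℂ E]
    [CompleteSpace E] : Set (E →L[ℂ] E) :=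
  {S | IsSelfAdjoint S ∧ Function.Injective S}

/-! ### A bounded self-adjoint operator without eigenvalues. -/

section Jacobi

variable {E : Type*} [NormedAddCommGroup E] [InnerProductSpace ℂ E]

theorem Orthonormal.countable_of_separableSpace [TopologicalSpace.SeparableSpace E] {ι : Type*}
    {v : ι → E} (hv : Orthonormal ℂ v) : Countable ι := by
  refine Pairwise.countable_of_isOpen_disjoint (s := fun i => Metric.ball (v i) (1 / 2)) ?_
    (fun _ => Metric.isOpen_ball) (fun i => ⟨v i, Metric.mem_ball_self (by norm_num)⟩)
  intro i j hij
  refine Metric.ball_disjoint_ball ?_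
  have h : ‖v i - v j‖ ^ 2 = 2 := by
    rw [@norm_sub_sq ℂ, hv.1, hv.1, hv.2 hij]
    norm_num
  rw [dist_eq_norm]
  nlinarith [norm_nonneg (v i - v j)]

theorem exists_hilbertBasis_nat [CompleteSpace E] [TopologicalSpace.SeparableSpace E]
    (hE : ¬ FiniteDimensional ℂ E) : Nonempty (HilbertBasis ℕ ℂ E) := by
  obtain ⟨w, b, -⟩ := exists_hilbertBasis ℂ E
  have : Countable w := b.orthonormal.countable_of_separableSpace
  have : Infinite w := by
    by_contra hfin
    rw [not_infinite_iff_finite] at hfin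
    have := Fintype.ofFinite w
    exact hE b.toOrthonormalBasis.toBasis.finiteDimensional_of_finite
  obtain ⟨e⟩ := nonempty_equiv_of_countable (α := ℕ) (β := w)
  refine ⟨HilbertBasis.mk (b.orthonormal.comp e e.injective) ?_⟩
  rw [e.surjective.range_comp b, b.dense_span]

/-- A square-summable solution of `a (n + 2) = c * a (n + 1) - a n`, `a 1 = c * a 0` vanishes,
because `a (n + 1) ^ 2 - a n * a (n + 2)` does not depend on `n`. -/
theorem eq_zero_of_jacobi_recurrence {a : ℕ → ℂ} {c : ℂ} (ha : Tendsto a atTop (𝓝 0))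
    (h1 : a 1 = c * a 0) (h2 : ∀ n, a (n + 2) = c * a (n + 1) - a n) (n : ℕ) : a n = 0 := by
  have hconst : ∀ n, a (n + 1) ^ 2 - a n * a (n + 2) = a 0 ^ 2 := by
    intro n
    induction n with
    | zero => rw [h2, zero_add, h1]; ring
    | succ n ih => rw [← ih, h2 (n + 1), h2 n]; ring
  have hlim : Tendsto (fun n => a (n + 1) ^ 2 - a n * a (n + 2)) atTop (𝓝 (0 ^ 2 - 0 * 0)) :=
    (((tendsto_add_atTop_iff_nat 1).2 ha).pow 2).sub
      (ha.mul ((tendsto_add_atTop_iff_nat 2).2 ha))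
  simp only [hconst] at hlim
  -- The invariant equals `a 0 ^ 2` and tends to `0`.
  have h0 : a 0 = 0 := by
    have := tendsto_nhds_unique hlim tendsto_const_nhds
    simpa using this.symm
  have hpair : ∀ n, a n = 0 ∧ a (n + 1) = 0 := by
    intro n
    induction n with
    | zero => exact ⟨h0, by rw [zero_add, h1, h0, mul_zero]⟩
    | succ n ih => exact ⟨ih.2, by rw [h2, ih.1, ih.2]; simp⟩
  exact (hpair n).1

/-- The operator is `V + V*` with `V` the unilateral shift of a Hilbert basis. The coordinates of an
eigenvector satisfy the recurrence of `eq_zero_of_jacobi_recurrence`; its initial condition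
expresses `V* b₀ = 0`. -/
theorem exists_isSelfAdjoint_without_eigenvalues [CompleteSpace E]
    [TopologicalSpace.SeparableSpace E] (hE : ¬ FiniteDimensional ℂ E) :
    ∃ A : E →L[ℂ] E, IsSelfAdjoint A ∧ ∀ (c : ℂ) (x : E), A x = c • x → x = 0 := by
  obtain ⟨b⟩ := exists_hilbertBasis_nat hE
  have hs : Orthonormal ℂ (fun n => b (n + 1)) := b.orthonormal.comp _ (add_left_injective 1)
  let W : E →ₗᵢ[ℂ] E :=
    hs.orthogonalFamily.linearIsometry.comp b.repr.toLinearIsometry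
  have hW : ∀ n, W (b n) = b (n + 1) := by
    intro n
    change hs.orthogonalFamily.linearIsometry (b.repr (b n)) = b (n + 1)
    rw [b.repr_self, OrthogonalFamily.linearIsometry_apply_single]
    simp
  let V : E →L[ℂ] E := W.toContinuousLinearMap
  have hV : ∀ n, V (b n) = b (n + 1) := hW
  have hVadj : V.adjoint (b 0) = 0 := by
    apply b.repr.injective
    ext n
    rw [b.repr_apply_apply, ContinuousLinearMap.adjoint_inner_right, hV, b.orthonormal.2]
    · simp
    · simp
  refine ⟨V + V.adjoint, ?_, fun c x hx => ?_⟩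
  · rw [← ContinuousLinearMap.star_eq_adjoint]
    exact IsSelfAdjoint.add_star_self V
  have h0 : ⟪b 1, x⟫_ℂ = c * ⟪b 0, x⟫_ℂ := by
    rw [← inner_smul_right, ← hx, add_apply, inner_add_right,
      ContinuousLinearMap.adjoint_inner_right, hV, ← ContinuousLinearMap.adjoint_inner_left, hVadj]
    simp
  have h2 : ∀ n, ⟪b (n + 2), x⟫_ℂ = c * ⟪b (n + 1), x⟫_ℂ - ⟪b n, x⟫_ℂ := by
    intro n
    have hshift : ⟪b (n + 1), V x⟫_ℂ = ⟪b n, x⟫_ℂ := by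
      rw [← hV]
      exact W.inner_map_map _ _
    rw [← inner_smul_right, ← hx, add_apply, inner_add_right,
      ContinuousLinearMap.adjoint_inner_right, hV, hshift]
    ring
  have hlim : Tendsto (fun n => ⟪b n, x⟫_ℂ) atTop (𝓝 0) := by
    have h := (b.orthonormal.inner_products_summable x).tendsto_atTop_zero
    rw [tendsto_zero_iff_norm_tendsto_zero]
    have h' := (Real.continuous_sqrt.tendsto 0).comp h
    simpa [Function.comp_def, Real.sqrt_sq] using h'
  apply b.repr.injective
  ext n
  rw [b.repr_apply_apply, eq_zero_of_jacobi_recurrence hlim h0 h2 n]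
  simp

end Jacobi

/-! ### Extending operators from a closed subspace by a scalar. -/

section ExtendByScalar

variable {E : Type*} [NormedAddCommGroup E] [InnerProductSpace ℂ E]

/-- The operator acting as `B` on `K` and as the scalar `c` on `Kᗮ`. -/
noncomputable def extendByScalar (K : Submodule ℂ E) [CompleteSpace K] (c : ℝ) (B : K →L[ℂ] K) :
    E →L[ℂ] E :=
  K.subtypeL ∘L B ∘L K.orthogonalProjectionOnto + c • (1 - K.starProjection)

theorem extendByScalar_apply (K : Submodule ℂ E) [CompleteSpace K] (c : ℝ) (B : K →L[ℂ] K)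
    (x : E) : extendByScalar K c B x =
      B (K.orthogonalProjectionOnto x) + c • (x - K.starProjection x) := rfl

theorem continuous_extendByScalar (K : Submodule ℂ E) [CompleteSpace K] (c : ℝ) :
    Continuous (extendByScalar K c) := by
  unfold extendByScalar
  fun_prop

theorem extendByScalar_one (K : Submodule ℂ E) [CompleteSpace K] (c : ℝ) :
    extendByScalar K c 1 = K.starProjection + c • (1 - K.starProjection) := rfl

theorem extendByScalar_neg_one (K : Submodule ℂ E) [CompleteSpace K] (c : ℝ) :
    extendByScalar K c (-1) = -K.starProjection + c • (1 - K.starProjection) := by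
  ext x
  rw [extendByScalar_apply, neg_apply, one_apply_eq_self, Submodule.coe_neg]
  rfl

end ExtendByScalar

/-! ### Path connectedness of the injective bounded self-adjoint operators. -/

section Bounded

variable {E : Type*} [NormedAddCommGroup E] [InnerProductSpace ℂ E] [CompleteSpace E]

/-- On the path `t(1 - t)A + (1 - 2t)`, a nonzero kernel vector at an interior time would be an
eigenvector of `A`; at the endpoints the operator is `±1`. -/
theorem joinedIn_one_neg_one [TopologicalSpace.SeparableSpace E]
    (hE : ¬ FiniteDimensional ℂ E) : JoinedIn (injectiveSelfAdjoint E) 1 (-1) := by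
  obtain ⟨A, hA, hA'⟩ := exists_isSelfAdjoint_without_eigenvalues hE
  refine JoinedIn.ofLine
    (f := fun t : ℝ => (t * (1 - t)) • A + (1 - 2 * t) • (1 : E →L[ℂ] E)) ?_ ?_ ?_ ?_
  · fun_prop
  · simp
  · norm_num
  · rintro _ ⟨t, -, rfl⟩
    refine ⟨((IsSelfAdjoint.all _).smul hA).add ((IsSelfAdjoint.all _).smul (.one _)), ?_⟩
    rw [injective_iff_map_eq_zero]
    intro x hx
    simp only [add_apply, smul_apply,
      one_apply_eq_self] at hx
    by_cases ht : t * (1 - t) = 0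
    · rw [ht, zero_smul, zero_add] at hx
      refine (smul_eq_zero.1 hx).resolve_left fun h => ?_
      nlinarith
    · refine hA' (((-(t * (1 - t))⁻¹ * (1 - 2 * t) : ℝ)) : ℂ) x ?_
      rw [Complex.coe_smul, mul_smul, neg_smul, ← smul_neg, ← eq_neg_of_add_eq_zero_left hx,
        smul_smul, inv_mul_cancel₀ ht, one_smul]

theorem extendByScalar_mem (K : Submodule ℂ E) [CompleteSpace K] {c : ℝ} (hc : c ≠ 0)
    {B : K →L[ℂ] K} (hB : B ∈ injectiveSelfAdjoint K) :
    extendByScalar K c B ∈ injectiveSelfAdjoint E := by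
  constructor
  · refine IsSelfAdjoint.add ?_ ((IsSelfAdjoint.all _).smul
      ((IsSelfAdjoint.one _).sub (isSelfAdjoint_starProjection K)))
    rw [ContinuousLinearMap.isSelfAdjoint_iff', ContinuousLinearMap.adjoint_comp,
      ContinuousLinearMap.adjoint_comp, K.adjoint_subtypeL, K.adjoint_orthogonalProjectionOnto,
      ContinuousLinearMap.isSelfAdjoint_iff'.1 hB.1, ContinuousLinearMap.comp_assoc]
  · rw [injective_iff_map_eq_zero]
    intro x hx
    rw [extendByScalar_apply] at hx
    have hperp : c • (x - K.starProjection x) ∈ Kᗮ := by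
      rw [← Complex.coe_smul]
      exact Kᗮ.smul_mem _ (K.sub_starProjection_mem_orthogonal x)
    have h := congrArg K.orthogonalProjectionOnto hx
    rw [map_add, K.orthogonalProjectionOnto_mem_subspace_eq_self,
      K.orthogonalProjectionOnto_eq_zero_iff.2 hperp, add_zero, map_zero] at h
    have hx0 : K.orthogonalProjectionOnto x = 0 := hB.2 (h.trans (map_zero B).symm)
    rw [K.starProjection_apply, hx0, map_zero, Submodule.coe_zero, zero_add, sub_zero] at hx
    exact (smul_eq_zero.1 hx).resolve_left hc

theorem joinedIn_extendByScalar [TopologicalSpace.SeparableSpace E] (K : Submodule ℂ E)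
    [CompleteSpace K] (hK : ¬ FiniteDimensional ℂ K) {c : ℝ} (hc : c ≠ 0) :
    JoinedIn (injectiveSelfAdjoint E) (K.starProjection + c • (1 - K.starProjection))
      (-K.starProjection + c • (1 - K.starProjection)) := by
  have : SecondCountableTopology E := UniformSpace.secondCountable_of_separable E
  rw [← extendByScalar_one, ← extendByScalar_neg_one]
  refine ((joinedIn_one_neg_one hK).map (continuous_extendByScalar K c)).mono ?_
  rintro _ ⟨B, hB, rfl⟩
  exact extendByScalar_mem K hc hB

/-- If `K` is finite-dimensional, the sign on `Kᗮ` is flipped. Otherwise the sign on `K` is flipped,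
giving `-1`, which is then joined to `1` on the whole space. -/
theorem joinedIn_symmetry_one [TopologicalSpace.SeparableSpace E]
    (hE : ¬ FiniteDimensional ℂ E) (K : Submodule ℂ E) [CompleteSpace K] :
    JoinedIn (injectiveSelfAdjoint E) (2 • K.starProjection - 1) 1 := by
  by_cases hK : FiniteDimensional ℂ K
  · have hK' : ¬ FiniteDimensional ℂ Kᗮ := fun h => hE <| by
      have : FiniteDimensional ℂ (K ⊔ Kᗮ : Submodule ℂ E) := inferInstance
      rw [K.sup_orthogonal_of_hasOrthogonalProjection] at this
      exact Module.Finite.of_surjective (⊤ : Submodule ℂ E).subtype fun x => ⟨⟨x, trivial⟩, rfl⟩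
    have h := (joinedIn_extendByScalar Kᗮ hK' one_ne_zero).symm
    rw [K.starProjection_orthogonal'] at h
    convert h using 1
    · module
    · module
  · have h := joinedIn_extendByScalar K hK (c := -1) (by norm_num)
    refine (JoinedIn.trans ?_ (joinedIn_one_neg_one hE).symm)
    convert h using 1
    · module
    · module

/-- With `K = (ker S⁺)ᗮ`, the projection onto `K` fixes the range of `S⁺` and kills that of `S⁻`,
because `S⁺ S⁻ = 0`. Hence the product is `S⁺ + S⁻`. -/
theorem exists_symmetry_mul_nonneg {S : E →L[ℂ] E} (hS : IsSelfAdjoint S) :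
    ∃ (K : Submodule ℂ E) (_ : CompleteSpace K), 0 ≤ (2 • K.starProjection - 1) * S := by
  have hp : 0 ≤ S⁺ := CFC.posPart_nonneg S
  have hn : 0 ≤ S⁻ := CFC.negPart_nonneg S
  let N : Submodule ℂ E := LinearMap.ker (S⁺ : E →L[ℂ] E).toLinearMap
  refine ⟨Nᗮ, inferInstance, ?_⟩
  have hpos : Nᗮ.starProjection * S⁺ = S⁺ := by
    ext x
    refine Submodule.starProjection_eq_self_iff.2 fun k hk => ?_
    have hk' : S⁺ k = 0 := hk
    change ⟪k, S⁺ x⟫_ℂ = 0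
    rw [← ContinuousLinearMap.adjoint_inner_left,
      ContinuousLinearMap.isSelfAdjoint_iff'.1 (IsSelfAdjoint.of_nonneg hp), hk', inner_zero_left]
  have hneg : Nᗮ.starProjection * S⁻ = 0 := by
    ext x
    refine (Submodule.starProjection_apply_eq_zero_iff Nᗮ).2 (N.le_orthogonal_orthogonal ?_)
    exact congrArg (fun T : E →L[ℂ] E => T x) (CFC.posPart_mul_negPart S)
  have h : (2 • Nᗮ.starProjection - 1) * S = S⁺ + S⁻ := by
    refine (congrArg _ (CFC.posPart_sub_negPart S hS).symm).trans ?_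
    rw [sub_mul, smul_mul_assoc, mul_sub, hpos, hneg, one_mul]
    module
  rw [h]
  exact add_nonneg hp hn

/-- As `J² = 1`, multiplying the segment by `J` gives `(1 - t) J S + t ≥ t`, which is injective for
`t > 0`; at `t = 0` injectivity is that of `S`. -/
theorem joinedIn_symmetry {S : E →L[ℂ] E} (hS : S ∈ injectiveSelfAdjoint E) (K : Submodule ℂ E)
    [CompleteSpace K] (hK : 0 ≤ (2 • K.starProjection - 1) * S) :
    JoinedIn (injectiveSelfAdjoint E) S (2 • K.starProjection - 1) := by
  set J : E →L[ℂ] E := 2 • K.starProjection - 1 with hJ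
  have hJs : IsSelfAdjoint J :=
    ((IsSelfAdjoint.all (2 : ℕ)).smul (isSelfAdjoint_starProjection K)).sub (.one _)
  have hJJ : J * J = 1 := by
    have hi : K.starProjection * K.starProjection = K.starProjection :=
      K.isIdempotentElem_starProjection
    rw [hJ, sub_mul, mul_sub, smul_mul_smul_comm, hi, one_mul, mul_one]
    module
  refine JoinedIn.ofLine (f := fun t : ℝ => (1 - t) • S + t • J) ?_ ?_ ?_ ?_
  · fun_prop
  · simp
  · simp
  · rintro _ ⟨t, ht, rfl⟩
    refine ⟨((IsSelfAdjoint.all _).smul hS.1).add ((IsSelfAdjoint.all _).smul hJs), ?_⟩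
    rcases ht.1.eq_or_lt with rfl | ht0
    · simpa using hS.2
    rw [injective_iff_map_eq_zero]
    intro x hx
    have h1 : (1 - t) • (J * S) x + t • x = 0 := by
      have h := congrArg J hx
      have hJx : J (J x) = x := congrArg (fun T : E →L[ℂ] E => T x) hJJ
      simpa [hJx] using h
    have h2 := congrArg (fun y => RCLike.re (⟪y, x⟫_ℂ)) h1
    have h3 : 0 ≤ RCLike.re ⟪(J * S) x, x⟫_ℂ :=
      ((ContinuousLinearMap.nonneg_iff_isPositive _).1 hK).re_inner_nonneg_left x
    simp only [← Complex.coe_smul, inner_add_left, inner_smul_left, Complex.conj_ofReal, map_add,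
      RCLike.re_to_complex, Complex.re_ofReal_mul, inner_zero_left, Complex.zero_re] at h2 h3
    have h4 : (⟪x, x⟫_ℂ).re = ‖x‖ ^ 2 := by
      rw [← RCLike.re_to_complex, inner_self_eq_norm_sq]
    rw [h4] at h2
    have h5 : ‖x‖ ^ 2 = 0 := by
      have := mul_nonneg (sub_nonneg.2 ht.2) h3
      have h6 : t * ‖x‖ ^ 2 = 0 := le_antisymm (by linarith) (by positivity)
      exact (mul_eq_zero.1 h6).resolve_left ht0.ne'
    simpa using h5

theorem isPathConnected_injectiveSelfAdjoint [TopologicalSpace.SeparableSpace E]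
    (hE : ¬ FiniteDimensional ℂ E) : IsPathConnected (injectiveSelfAdjoint E) := by
  refine ⟨1, (joinedIn_one_neg_one hE).source_mem, fun {S} hS => ?_⟩
  obtain ⟨K, _, hK⟩ := exists_symmetry_mul_nonneg hS.1
  exact ((joinedIn_symmetry hS K hK).trans (joinedIn_symmetry_one hE K)).symm

theorem IsSelfAdjoint.isUnit_one_add_I_smul {S : E →L[ℂ] E} (hS : IsSelfAdjoint S) :
    IsUnit (1 + Complex.I • S) := by
  have h : Complex.I ∉ spectrum ℂ S := fun h => by
    simpa using hS.im_eq_zero_of_mem_spectrum h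
  have h' := (spectrum.notMem_iff.1 h)
  have he : 1 + Complex.I • S =
      algebraMap ℂ (E →L[ℂ] E) (-Complex.I) * (algebraMap ℂ (E →L[ℂ] E) Complex.I - S) := by
    rw [mul_sub, ← map_mul, ← Algebra.smul_def]
    simp
  rw [he]
  exact ((isUnit_iff_ne_zero.2 (neg_ne_zero.2 Complex.I_ne_zero)).map _).mul h'

end Bounded

/-! ### The correspondence between `T` and its bounded inverse. -/

namespace SelfAdjointOperator

variable {H : Type*} [NormedAddCommGroup H] [InnerProductSpace ℂ H]

/-- The inverse of an injective bounded operator, defined on the range. -/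
noncomputable def inversePMap (S : H →L[ℂ] H) (hS : Function.Injective S) : H →ₗ.[ℂ] H where
  domain := LinearMap.range S.toLinearMap
  toFun := (LinearEquiv.ofInjective S.toLinearMap hS).symm.toLinearMap

theorem inversePMap_apply (S : H →L[ℂ] H) (hS : Function.Injective S) (y : H)
    (hy : S y ∈ (inversePMap S hS).domain) : inversePMap S hS ⟨S y, hy⟩ = y :=
  (LinearEquiv.ofInjective S.toLinearMap hS).symm_apply_apply y

variable [CompleteSpace H]

/-- The domain is dense because `(ran S)ᗮ = ker S = 0`. -/
theorem isSelfAdjoint_inversePMap (S : H →L[ℂ] H) (hS : S ∈ injectiveSelfAdjoint H) :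
    IsSelfAdjoint (inversePMap S hS.2) := by
  have hsymm : ∀ x y : H, ⟪S x, y⟫_ℂ = ⟪x, S y⟫_ℂ := fun x y =>
    ContinuousLinearMap.isSelfAdjoint_iff_isSymmetric.1 hS.1 x y
  have hdense : Dense ((inversePMap S hS.2).domain : Set H) := by
    rw [Submodule.dense_iff_topologicalClosure_eq_top,
      Submodule.topologicalClosure_eq_top_iff, Submodule.eq_bot_iff]
    intro w hw
    refine hS.2 ((ext_inner_right ℂ fun v => ?_).trans (map_zero S).symm)
    rw [hsymm, inner_zero_left]
    exact (Submodule.mem_orthogonal' _ _).1 hw _ ⟨v, rfl⟩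
  have hformal : (inversePMap S hS.2).IsFormalAdjoint (inversePMap S hS.2) := by
    rintro ⟨_, x, rfl⟩ ⟨_, y, rfl⟩
    have h1 := inversePMap_apply S hS.2 x ⟨x, rfl⟩
    have h2 := inversePMap_apply S hS.2 y ⟨y, rfl⟩
    exact (congrArg (⟪·, S y⟫_ℂ) h1).trans ((hsymm x y).symm.trans (congrArg (⟪S x, ·⟫_ℂ) h2).symm)
  refine le_antisymm ?_ (hformal.le_adjoint hdense)
  rw [← LinearPMap.le_graph_iff]
  rintro ⟨a, z⟩ hp
  obtain ⟨y, hy, hz⟩ := (LinearPMap.mem_graph_iff _).1 hp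
  -- Testing the adjoint relation on `S v` gives `⟪z, S v⟫ = ⟪a, v⟫`, so `a = S z` already lies in
  -- the range of `S`.
  have hSz : S z = a := by
    refine ext_inner_right ℂ fun v => ?_
    have h := LinearPMap.adjoint_isFormalAdjoint hdense y ⟨S v, v, rfl⟩
    have hv := inversePMap_apply S hS.2 v ⟨v, rfl⟩
    rw [hsymm]
    exact (congrArg (⟪·, S v⟫_ℂ) hz).symm.trans <| h.trans ((congrArg (⟪(y : H), ·⟫_ℂ) hv).trans (congrArg (⟪·, v⟫_ℂ) hy))
  refine (LinearPMap.mem_graph_iff _).2 ⟨⟨S z, z, rfl⟩, hSz, inversePMap_apply S hS.2 z _⟩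

/-- The self-adjoint operator whose inverse is `S`. -/
noncomputable def ofInverse (S : injectiveSelfAdjoint H) : SelfAdjointOperator H :=
  ⟨inversePMap S.1 S.2.2, isSelfAdjoint_inversePMap S.1 S.2⟩

theorem isInvertible_ofInverse (S : injectiveSelfAdjoint H) : (ofInverse S).IsInvertible := by
  refine ⟨S.1, ?_, fun y => ⟨⟨y, rfl⟩, inversePMap_apply S.1 S.2.2 y _⟩⟩
  rintro ⟨_, x, rfl⟩
  exact congrArg S.1 (inversePMap_apply S.1 S.2.2 x ⟨x, rfl⟩)

theorem IsInvertible.exists_ofInverse_eq {T : SelfAdjointOperator H} (hT : T.IsInvertible) :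
    ∃ S : injectiveSelfAdjoint H, ofInverse S = T := by
  obtain ⟨S, hl, hr⟩ := hT
  choose hmem hr using hr
  have hinj : Function.Injective S := fun x y hxy => by
    rw [← hr x, ← hr y]
    congr 2
  have hsa : IsSelfAdjoint S := by
    refine ContinuousLinearMap.isSelfAdjoint_iff_isSymmetric.2 fun x y => ?_
    have h := T.symmetric ⟨S x, hmem x⟩ ⟨S y, hmem y⟩
    rw [hr, hr] at h
    exact h.symm
  refine ⟨⟨S, hsa, hinj⟩, Subtype.ext (le_antisymm ?_ ?_)⟩ <;> rw [← LinearPMap.le_graph_iff]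
  · rintro ⟨a, b⟩ hp
    obtain ⟨⟨_, x, rfl⟩, rfl, rfl⟩ := (LinearPMap.mem_graph_iff _).1 hp
    exact (LinearPMap.mem_graph_iff _).2
      ⟨⟨S x, hmem x⟩, rfl, (hr x).trans (inversePMap_apply S hinj x ⟨x, rfl⟩).symm⟩
  · rintro ⟨a, b⟩ hp
    obtain ⟨x, rfl, rfl⟩ := (LinearPMap.mem_graph_iff _).1 hp
    exact (LinearPMap.mem_graph_iff _).2
      ⟨⟨S (T.toLinearPMap x), _, rfl⟩, hl x, inversePMap_apply S hinj _ _⟩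

/-- This follows from `(T + i) S y = (1 + iS) y`. -/
theorem resolventI_ofInverse (S : injectiveSelfAdjoint H) :
    (ofInverse S).resolventI = S.1 * Ring.inverse (1 + Complex.I • S.1) := by
  have h : (ofInverse S).resolventI * (1 + Complex.I • S.1) = S.1 := by
    ext y
    have hy := (ofInverse S).resolventI_addI ⟨S.1 y, y, rfl⟩
    rw [addI_apply] at hy
    have hy' : (ofInverse S).toLinearPMap ⟨S.1 y, y, rfl⟩ = y :=
      inversePMap_apply S.1 S.2.2 y ⟨y, rfl⟩
    rw [hy'] at hy
    exact hy
  exact (Ring.eq_mul_inverse_iff_mul_eq _ _ _ S.2.1.isUnit_one_add_I_smul).2 h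

/-- The graph metric is pulled back along `resolventI`, and inversion is norm continuous at the unit
`1 + iS`. -/
theorem continuous_ofInverse : Continuous (ofInverse : injectiveSelfAdjoint H → _) := by
  have hind : IsInducing (resolventI : SelfAdjointOperator H → H →L[ℂ] H) :=
    (Isometry.of_dist_eq fun T₁ T₂ => dist_eq_norm _ _).isUniformInducing.isInducing
  rw [hind.continuous_iff, continuous_iff_continuousAt]
  intro S
  have heq : resolventI ∘ (ofInverse : injectiveSelfAdjoint H → _) =
      fun S => S.1 * Ring.inverse (1 + Complex.I • S.1) := funext resolventI_ofInverse
  rw [heq]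
  obtain ⟨u, hu⟩ := S.2.1.isUnit_one_add_I_smul
  have hinv := NormedRing.inverse_continuousAt u
  rw [hu] at hinv
  have hlin : Continuous fun S : injectiveSelfAdjoint H => 1 + Complex.I • S.1 := by fun_prop
  exact continuous_subtype_val.continuousAt.mul
    (ContinuousAt.comp (g := Ring.inverse) hinv hlin.continuousAt)

end SelfAdjointOperator

theorem propositionS3 (H : Type*) [NormedAddCommGroup H] [InnerProductSpace ℂ H]
    [CompleteSpace H] [TopologicalSpace.SeparableSpace H] (hH : ¬ FiniteDimensional ℂ H) :
    IsPathConnected {T : SelfAdjointOperator H | T.IsInvertible} := by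
  have := isPathConnected_iff_pathConnectedSpace.1 (isPathConnected_injectiveSelfAdjoint hH)
  have h := isPathConnected_range (SelfAdjointOperator.continuous_ofInverse (H := H))
  convert h using 1
  ext T
  refine ⟨fun hT => hT.exists_ofInverse_eq, ?_⟩
  rintro ⟨S, rfl⟩
  exact SelfAdjointOperator.isInvertible_ofInverse S
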